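/- \textbf{Definitions.} A \emph{conditional algebra} is a pair $\langle A,\to\rangle$ where $A$ is a Boolean algebra and $\to$ is a binary operation on $A$ such that $a\to 1=1$, $(a\to b)\wedge(a\to c)=a\to(b\wedge c)$ and $(a\vee b)\to c\le (a\to c)\wedge(b\to c)$ for all $a,b,c\in A$. A \emph{conditional homomorphism} is a Boolean homomorphism $h$ with $h(a\to b)=h(a)\to h(b)$. Let $\langle X,\tau\rangle$ be a topological space, $\mathrm{Closed}(\tau)$ and $\mathrm{Clop}(\tau)$ its families of closed and of clopen sets, and $T\subseteq X\times \mathrm{Closed}(\tau)\times X$. Write $T(x,Y)=\{y\in X: T(x,Y,y)\}$ and $U\to_T V=\{x\in X: T(x,Z)\subseteq V\text{ for every closed }Z\subseteq U\}$. The triple $\langle X,\tau,T\rangle$ is a \emph{conditional space} if $\langle X,\tau\rangle$ is Boolean (compact, Hausdorff, zero-dimensional) and (T1) $T(x,Y)$ is closed for all $x\in X$ and all closed $Y$; (T2) $U\to_T V$ is clopen for all clopen $U,V$; (T3) for all $x,y\in X$ and all closed $Y$: $T(x,Y,y)$ if and only if $T(x,U,y)$ for all clopen $U\supseteq Y$.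 A \emph{conditional function} from $\langle X_1,\tau_1,T_1\rangle$ to $\langle X_2,\tau_2,T_2\rangle$ is a continuous map $f:X_1\to X_2$ such that for all $x\in X_1$ and $U,V\in\mathrm{Clop}(\tau_2)$: $T_1(x,f^{-1}[U])\subseteq f^{-1}[V]$ if and only if $T_2(f(x),U)\subseteq V$. An \emph{isomorphism} of conditional spaces is a homeomorphism $\varepsilon:X_1\to X_2$ such that $T_1(x,Z,y)$ if and only if $T_2(\varepsilon(x),\varepsilon[Z],\varepsilon(y))$, for all $x,y\in X_1$ and $Z\subseteq X_1$. $\mathbf{CA}$ is the category of conditional algebras and conditional homomorphisms, and $\mathbf{CS}$ is the category of conditional spaces and conditional functions (with the usual identities and composition). For a conditional algebra $A$ let $\mathrm{Ul}(A)$ be its set of ultrafilters (maximal proper filters), $\varphi(a)=\{u\in\mathrm{Ul}(A): a\in u\}$ and $\varphi(F)=\{u\in\mathrm{Ul}(A): F\subseteq u\}$ for a (possibly improper) filter $F$ of $A$. Let $\tau_s$ be the topology on $\mathrm{Ul}(A)$ generated by the sets $\varphi(a)$, $a\in A$. For $u,v\in\mathrm{Ul}(A)$ and $Z\subseteq\mathrm{Ul}(A)$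 let $T_A(u,Z,v)$ hold if and only if there is a filter $F$ of $A$ such that $Z=\varphi(F)$ and $\{b\in A: a\to b\in u\text{ for some }a\in F\}\subseteq v$. \textbf{Theorem.} (i) For every conditional algebra $A$, $\langle\mathrm{Ul}(A),\tau_s,T_A\rangle$ is a conditional space; for every conditional homomorphism $h:A\to B$, $f_h:\mathrm{Ul}(B)\to\mathrm{Ul}(A)$, $f_h(u)=h^{-1}[u]$, is a conditional function. This defines a contravariant functor $G:\mathbf{CA}\to\mathbf{CS}$. (ii) For every conditional space $\langle X,\tau,T\rangle$, $\langle\mathrm{Clop}(\tau),\to_T\rangle$ is a conditional algebra; for every conditional function $f:X_1\to X_2$, $h_f:\mathrm{Clop}(\tau_2)\to\mathrm{Clop}(\tau_1)$, $h_f(U)=f^{-1}[U]$, is a conditional homomorphism. This defines a contravariant functor $H:\mathbf{CS}\to\mathbf{CA}$. (iii) For every conditional space $X$, the map $\varepsilon:X\to\mathrm{Ul}(\mathrm{Clop}(X))$, $\varepsilon(x)=\{U\in\mathrm{Clop}(X): x\in U\}$, is an isomorphism of conditional spaces from $X$ onto $G(H(X))$. (iv) The categories $\mathbf{CA}$ and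 $\mathbf{CS}$ are dually equivalent: $G$ and $H$ form an equivalence between $\mathbf{CA}^{\mathrm{op}}$ and $\mathbf{CS}$; the maps $\varphi:A\to\mathrm{Clop}(\mathrm{Ul}(A))$ form a natural isomorphism $\mathrm{Id}_{\mathbf{CA}}\cong H\circ G$, and the maps $\varepsilon$ form a natural isomorphism $\mathrm{Id}_{\mathbf{CS}}\cong G\circ H$. -/

import Mathlib

open CategoryTheory Opposite TopologicalSpace Order

universe u v

namespace CondDuality

/-! ### Conditional algebras -/

/-- The axioms (C1), (C2), (C3) of a conditional on a Boolean algebra. -/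
structure IsConditional {A : Type u} [BooleanAlgebra A] (c : A → A → A) : Prop where
  top_right : ∀ a, c a ⊤ = ⊤
  inf_right : ∀ a b d, c a b ⊓ c a d = c a (b ⊓ d)
  sup_left : ∀ a b d, c (a ⊔ b) d ≤ c a d ⊓ c b d

/-- A conditional homomorphism is a Boolean homomorphism (`h` below) that moreover
preserves the conditional. -/
def IsConditionalHom {A : Type u} {B : Type v} [BooleanAlgebra A] [BooleanAlgebra B]
    (c : A → A → A) (d : B → B → B) (h : BoundedLatticeHom A B) : Prop :=
  ∀ a b, h (c a b) = d (h a) (h b)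

/-! ### Ultrafilters of Boolean algebras and Stone spaces -/

section Stone

variable {A : Type u} [BooleanAlgebra A]

/-- `F` is an ultrafilter: maximal, with respect to inclusion, among the proper filters.
Here `Order.PFilter A` is the type of all filters of `A`, the improper one included. -/
def IsUltra (F : PFilter A) : Prop :=
  Maximal (fun G : PFilter A => (G : Set A) ≠ Set.univ) F

lemma pfilter_ne_univ_iff (F : PFilter A) : (F : Set A) ≠ Set.univ ↔ ⊥ ∉ F := by
  rw [not_iff_comm, not_not]
  constructor
  · intro h
    exact Set.eq_univ_of_forall fun a => PFilter.mem_of_le bot_le h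
  · intro h
    have : (⊥ : A) ∈ (F : Set A) := h ▸ Set.mem_univ _
    exact this

lemma isUltra_of_mem_or_compl_mem {F : PFilter A} (h0 : ⊥ ∉ F)
    (h : ∀ a, a ∈ F ∨ aᶜ ∈ F) : IsUltra F := by
  refine ⟨(pfilter_ne_univ_iff F).2 h0, fun G hG hFG a ha => ?_⟩
  rcases h a with h' | h'
  · exact h'
  · exfalso
    apply (pfilter_ne_univ_iff G).1 hG
    have := PFilter.inf_mem ha (hFG h')
    rwa [inf_compl_eq_bot] at this

lemma IsUltra.mem_or_compl_mem {F : PFilter A} (hF : IsUltra F) (a : A) :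
    a ∈ F ∨ aᶜ ∈ F := by
  by_contra! hcon
  have hP : IsPFilter {x : A | ∃ f ∈ F, f ⊓ a ≤ x} := by
    refine IsPFilter.of_def ⟨⊤, ⊤, PFilter.top_mem, le_top⟩ ?_ ?_
    · rintro x ⟨f, hf, hx⟩ y ⟨g, hg, hy⟩
      refine ⟨x ⊓ y, ⟨f ⊓ g, PFilter.inf_mem hf hg, le_inf ?_ ?_⟩, inf_le_left, inf_le_right⟩
      · exact le_trans (inf_le_inf_right a inf_le_left) hx
      · exact le_trans (inf_le_inf_right a inf_le_right) hy
    · rintro x y hxy ⟨f, hf, hx⟩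
      exact ⟨f, hf, hx.trans hxy⟩
  have hmem : ∀ x, x ∈ hP.toPFilter ↔ ∃ f ∈ F, f ⊓ a ≤ x := fun x => Iff.rfl
  have hprop : ((hP.toPFilter : PFilter A) : Set A) ≠ Set.univ := by
    rw [pfilter_ne_univ_iff, hmem]
    rintro ⟨f, hf, hfa⟩
    exact hcon.2 (PFilter.mem_of_le (disjoint_iff_inf_le.2 hfa).le_compl_right hf)
  have hle : F ≤ hP.toPFilter := fun x hx => (hmem x).2 ⟨x, hx, inf_le_left⟩
  exact hcon.1 (hF.2 hprop hle ((hmem a).2 ⟨⊤, PFilter.top_mem, inf_le_right⟩))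

end Stone

/-- `Ul(A)`, the set of ultrafilters of the Boolean algebra `A`. -/
def Ul (A : Type u) [BooleanAlgebra A] : Type u := {F : PFilter A // IsUltra F}

namespace Ul

variable {A : Type u} [BooleanAlgebra A] {B : Type v} [BooleanAlgebra B]

/-- The underlying filter of an ultrafilter. -/
def toFilter (p : Ul A) : PFilter A := p.1

@[ext]
lemma ext {p q : Ul A} (h : ∀ a, a ∈ p.toFilter ↔ a ∈ q.toFilter) : p = q :=
  Subtype.ext (SetLike.ext h)

end Ul

section Stone2

variable {A : Type u} [BooleanAlgebra A] {B : Type v} [BooleanAlgebra B]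

/-- The Stone mapping `φ(a) = {p ∈ Ul(A) : a ∈ p}`. -/
def stoneMap (a : A) : Set (Ul A) := {p | a ∈ p.toFilter}

/-- `φ(F) = {p ∈ Ul(A) : F ⊆ p}` for a filter `F`. -/
def stoneFilterMap (F : PFilter A) : Set (Ul A) := {p | F ≤ p.toFilter}

/-- The Stone topology on `Ul(A)`. -/
instance : TopologicalSpace (Ul A) := generateFrom (Set.range (stoneMap (A := A)))

/-- The map `f_h : Ul(B) → Ul(A)`, `f_h(p) = h⁻¹[p]`, of a Boolean homomorphism `h : A → B`. -/
def ulMap (h : BoundedLatticeHom A B) (p : Ul B) : Ul A :=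
  have hP : IsPFilter {a : A | h a ∈ p.toFilter} := by
    refine IsPFilter.of_def ⟨⊤, ?_⟩ ?_ ?_
    · simp
    · intro x hx y hy
      refine ⟨x ⊓ y, ?_, inf_le_left, inf_le_right⟩
      change h (x ⊓ y) ∈ p.toFilter
      rw [map_inf]
      exact PFilter.inf_mem hx hy
    · intro x y hxy hx
      exact PFilter.mem_of_le (OrderHomClass.mono h hxy) hx
  ⟨hP.toPFilter, by
    apply isUltra_of_mem_or_compl_mem
    · intro h0
      have h1 : h ⊥ ∈ p.toFilter := h0
      rw [map_bot] at h1
      exact (pfilter_ne_univ_iff _).1 p.2.1 h1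
    · intro a
      have h1 := p.2.mem_or_compl_mem (h a)
      rw [← map_compl'] at h1
      exact h1⟩

@[simp]
lemma mem_ulMap (h : BoundedLatticeHom A B) (p : Ul B) (a : A) :
    a ∈ (ulMap h p).toFilter ↔ h a ∈ p.toFilter := Iff.rfl

/-- The map `ε : X → Ul(Clop(X))`, `ε(x) = {U clopen : x ∈ U}`. -/
def pointUl {X : Type u} [TopologicalSpace X] (x : X) : Ul (Clopens X) :=
  have hP : IsPFilter {U : Clopens X | x ∈ U} := by
    refine IsPFilter.of_def ⟨⊤, Set.mem_univ x⟩ ?_ ?_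
    · intro U hU V hV
      exact ⟨U ⊓ V, ⟨hU, hV⟩, inf_le_left, inf_le_right⟩
    · intro U V hUV hU
      exact hUV hU
  ⟨hP.toPFilter, by
    apply isUltra_of_mem_or_compl_mem
    · intro h0
      exact Set.notMem_empty x h0
    · intro U
      exact Classical.em (x ∈ U)⟩

/-- The Boolean homomorphism `h_f : Clop(Y) → Clop(X)`, `h_f(U) = f⁻¹[U]`, of a continuous
map `f : X → Y`. -/
def clopMap {X : Type u} {Y : Type v} [TopologicalSpace X] [TopologicalSpace Y]
    (f : X → Y) (hf : Continuous f) : BoundedLatticeHom (Clopens Y) (Clopens X) where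
  toFun U := ⟨f ⁻¹' U, U.isClopen.preimage hf⟩
  map_sup' _ _ := rfl
  map_inf' _ _ := rfl
  map_top' := rfl
  map_bot' := rfl

/-- `D_X(Y) = {b : ∃ a ∈ Y, a → b ∈ X}`. -/
def D (c : A → A → A) (X Y : Set A) : Set A := {b | ∃ a ∈ Y, c a b ∈ X}

/-- The hybrid relation `T_A` on `Ul(A)`: `T_A(p, Z, q)` iff there is a filter `F` with
`Z = φ(F)` and `D_p(F) ⊆ q`. -/
def ulRel (c : A → A → A) (p : Ul A) (Z : Set (Ul A)) (q : Ul A) : Prop :=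
  ∃ F : PFilter A, Z = stoneFilterMap F ∧ D c (p.toFilter : Set A) F ⊆ q.toFilter

end Stone2

/-! ### Conditional spaces -/

/-- `T(x, Z) = {y : T(x, Z, y)}`. -/
def image {X : Type u} (T : X → Set X → X → Prop) (x : X) (Z : Set X) : Set X := {y | T x Z y}

/-- The operation `U →_T V = {x : T(x, Z) ⊆ V for all Z ⊆ U with Z ∈ 𝓕}`, for a hybrid relation
`T ⊆ X × 𝓕 × X`. -/
def setCond {X : Type u} (𝓕 : Set (Set X)) (T : X → Set X → X → Prop) (U V : Set X) : Set X :=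
  {x | ∀ Z ∈ 𝓕, Z ⊆ U → image T x Z ⊆ V}

/-- A Boolean space: compact, Hausdorff and zero-dimensional (the clopen sets form a basis). -/
structure IsBooleanSpace (X : Type u) [TopologicalSpace X] : Prop where
  compact : CompactSpace X
  hausdorff : T2Space X
  zeroDim : IsTopologicalBasis {U : Set X | IsClopen U}

/-- `⟨X, τ, T⟩` is a conditional space: `X` is a Boolean space, `T ⊆ X × Closed(X) × X`, and
(T1), (T2), (T3) hold. -/
structure IsConditionalSpace (X : Type u) [TopologicalSpace X] (T : X → Set X → X → Prop) :
    Prop where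
  boolean : IsBooleanSpace X
  closed_mid : ∀ x Y y, T x Y y → IsClosed Y
  isClosed_image : ∀ x Y, IsClosed Y → IsClosed (image T x Y)
  isClopen_cond : ∀ U V : Set X, IsClopen U → IsClopen V →
    IsClopen (setCond {Z | IsClosed Z} T U V)
  rel_iff : ∀ x Y y, IsClosed Y → (T x Y y ↔ ∀ U : Set X, IsClopen U → Y ⊆ U → T x U y)

/-- A conditional function between conditional spaces: a continuous map satisfying (CF). -/
structure IsConditionalFunction {X : Type u} {Y : Type v} [TopologicalSpace X]
    [TopologicalSpace Y] (T : X → Set X → X → Prop) (S : Y → Set Y → Y → Prop) (f : X → Y) :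
    Prop where
  continuous : Continuous f
  image_subset_iff : ∀ x (U V : Set Y), IsClopen U → IsClopen V →
    (image T x (f ⁻¹' U) ⊆ f ⁻¹' V ↔ image S (f x) U ⊆ V)

/-- An isomorphism of conditional spaces: a homeomorphism preserving and reflecting the
hybrid relation. -/
structure IsConditionalIso {X : Type u} {Y : Type v} [TopologicalSpace X]
    [TopologicalSpace Y] (T : X → Set X → X → Prop) (S : Y → Set Y → Y → Prop) (f : X → Y) :
    Prop where
  isHomeomorph : IsHomeomorph f
  rel_iff : ∀ x Z y, T x Z y ↔ S (f x) (f '' Z) (f y)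

/-! ### The categories -/

/-- Conditional algebras. -/
structure CA : Type (u + 1) where
  carrier : Type u
  [str : BooleanAlgebra carrier]
  cond : carrier → carrier → carrier
  isConditional : IsConditional cond

attribute [instance] CA.str

/-- Conditional spaces. -/
structure CS : Type (u + 1) where
  carrier : Type u
  [top : TopologicalSpace carrier]
  rel : carrier → Set carrier → carrier → Prop
  isConditionalSpace : IsConditionalSpace carrier rel

attribute [instance] CS.top

/-- Conditional homomorphisms. -/
@[ext]
structure CA.Hom (A B : CA.{u}) : Type u where
  hom : BoundedLatticeHom A.carrier B.carrier
  isConditionalHom : IsConditionalHom A.cond B.cond hom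

/-- Conditional functions. -/
@[ext]
structure CS.Hom (X Y : CS.{u}) : Type u where
  toFun : X.carrier → Y.carrier
  isConditionalFunction : IsConditionalFunction X.rel Y.rel toFun

/-- The category of conditional algebras and conditional homomorphisms. -/
instance : Category CA.{u} where
  Hom := CA.Hom
  id A := ⟨BoundedLatticeHom.id A.carrier, fun _ _ => rfl⟩
  comp f g := ⟨g.hom.comp f.hom, fun a b => by
    simp [f.isConditionalHom a b, g.isConditionalHom (f.hom a) (f.hom b)]⟩

/-- The category of conditional spaces and conditional functions. -/
instance : Category CS.{u} where
  Hom := CS.Hom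
  id X := ⟨id, continuous_id, fun _ _ _ _ _ => Iff.rfl⟩
  comp f g := ⟨g.toFun ∘ f.toFun,
    g.isConditionalFunction.continuous.comp f.isConditionalFunction.continuous,
    fun x U V hU hV =>
      (f.isConditionalFunction.image_subset_iff x _ _
        (hU.preimage g.isConditionalFunction.continuous)
        (hV.preimage g.isConditionalFunction.continuous)).trans
      (g.isConditionalFunction.image_subset_iff (f.toFun x) U V hU hV)⟩

/-- The operation `→_T` on the clopen sets of a conditional space. -/
def CS.cond (X : CS.{u}) (U V : Clopens X.carrier) : Clopens X.carrier :=
  ⟨setCond {Z | IsClosed Z} X.rel U V,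
    X.isConditionalSpace.isClopen_cond U V U.isClopen V.isClopen⟩

/-- `Es(A) = ⟨Ul(A), τ_s, T_A⟩`, once it is known to be a conditional space. -/
def Es (hEs : ∀ A : CA.{u}, IsConditionalSpace (Ul A.carrier) (ulRel A.cond)) (A : CA.{u}) :
    CS.{u} where
  carrier := Ul A.carrier
  rel := ulRel A.cond
  isConditionalSpace := hEs A

/-- `Co(X) = ⟨Clop(X), →_T⟩`, once it is known to be a conditional algebra. -/
def Co (hCo : ∀ X : CS.{u}, IsConditional X.cond) (X : CS.{u}) : CA.{u} where
  carrier := Clopens X.carrier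
  cond := X.cond
  isConditional := hCo X

/-- The contravariant functor `G : CA → CS` with `A ↦ Es(A)`, `h ↦ f_h`, once these are known to
be a conditional space and a conditional function. -/
def functorG (hEs : ∀ A : CA.{u}, IsConditionalSpace (Ul A.carrier) (ulRel A.cond))
    (hG : ∀ (A B : CA.{u}) (h : A ⟶ B),
      IsConditionalFunction (ulRel B.cond) (ulRel A.cond) (ulMap h.hom)) :
    CA.{u}ᵒᵖ ⥤ CS.{u} where
  obj A := Es hEs A.unop
  map {A B} h := ⟨ulMap h.unop.hom, hG B.unop A.unop h.unop⟩
  map_id _ := rfl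
  map_comp _ _ := rfl

/-- The contravariant functor `H : CS → CA` with `X ↦ Co(X)`, `f ↦ h_f`, once these are known to
be a conditional algebra and a conditional homomorphism. -/
def functorH (hCo : ∀ X : CS.{u}, IsConditional X.cond)
    (hH : ∀ (X Y : CS.{u}) (f : X ⟶ Y),
      IsConditionalHom Y.cond X.cond (clopMap f.toFun f.isConditionalFunction.continuous)) :
    CS.{u}ᵒᵖ ⥤ CA.{u} where
  obj X := Co hCo X.unop
  map {X Y} f := ⟨clopMap f.unop.toFun f.unop.isConditionalFunction.continuous,
    hH Y.unop X.unop f.unop⟩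
  map_id _ := rfl
  map_comp _ _ := rfl

end CondDuality

open CondDuality

namespace CondDuality

/-! ### Stone duality for Boolean algebras -/

section StoneDuality

variable {A : Type u} [BooleanAlgebra A]

/-! Stone duality settles the Boolean part, so only the relation and the conditional have to be
matched. By (T3) a conditional relation is determined by its values at clopen middle arguments and
is antitone there, whence `U →_T V` is just `{x : T(x, U) ⊆ V}`.

For an algebra the key fact is `image_ulRel_subset_iff`: `T_A(p, φ(a)) ⊆ φ(b)` iff `a → b ∈ p`. It
follows from the ultrafilter theorem applied to the filter `{d : a → d ∈ p}`. It yields (T2), the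
condition on `f_h`, and the fact that `φ` preserves the conditional.

For a space, `T(x, U)` is closed, hence the intersection of the clopen `V` containing it, that is,
of those with `x ∈ U →_T V`. So `ε` preserves and reflects the relation at clopen `U`, and (T3) on
both sides extends this to closed sets. Both naturality squares commute by definition. -/

lemma Ul.bot_notMem (p : Ul A) : ⊥ ∉ p.toFilter :=
  (pfilter_ne_univ_iff _).1 p.2.1

lemma Ul.compl_mem_iff (p : Ul A) (a : A) : aᶜ ∈ p.toFilter ↔ a ∉ p.toFilter := by
  refine ⟨fun h h' => p.bot_notMem ?_, fun h => (p.2.mem_or_compl_mem a).resolve_left h⟩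
  simpa using PFilter.inf_mem h' h

lemma Ul.sup_mem_iff (p : Ul A) (a b : A) :
    a ⊔ b ∈ p.toFilter ↔ a ∈ p.toFilter ∨ b ∈ p.toFilter := by
  rw [← not_iff_not, ← p.compl_mem_iff, compl_sup, PFilter.inf_mem_iff, p.compl_mem_iff,
    p.compl_mem_iff, not_or]

/-- The ultrafilter theorem for Boolean algebras. -/
lemma exists_ul_of_notMem {F : PFilter A} {a : A} (ha : a ∉ F) :
    ∃ p : Ul A, F ≤ p.toFilter ∧ a ∉ p.toFilter := by
  have hd : Disjoint (F : Set A) (Ideal.principal a : Set A) :=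
    Set.disjoint_left.2 fun x hx hxa => ha (PFilter.mem_of_le hxa hx)
  -- The complement of a prime ideal that contains `a` and misses `F` is the required ultrafilter.
  obtain ⟨J, hJ, haJ, hFJ⟩ := DistribLattice.prime_ideal_of_disjoint_filter_ideal hd
  have hmem : ∀ x, x ∈ hJ.compl_filter.toPFilter ↔ x ∉ J := fun x => Iff.rfl
  refine ⟨⟨hJ.compl_filter.toPFilter, isUltra_of_mem_or_compl_mem ?_ ?_⟩, ?_, ?_⟩
  · rw [hmem, not_not]
    exact J.bot_mem
  · intro x
    rw [hmem, hmem, ← not_and_or]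
    rintro ⟨h1, h2⟩
    exact hJ.toIsProper.notMem_of_compl_mem h2 h1
  · exact fun x hx => (hmem x).2 (Set.disjoint_left.1 hFJ hx)
  · exact fun h => (hmem a).1 h (haJ (Ideal.mem_principal.2 le_rfl))

@[simp]
lemma mem_stoneMap {a : A} {p : Ul A} : p ∈ stoneMap a ↔ a ∈ p.toFilter := Iff.rfl

lemma stoneMap_top : stoneMap (⊤ : A) = Set.univ :=
  Set.eq_univ_of_forall fun _ => PFilter.top_mem

lemma stoneMap_bot : stoneMap (⊥ : A) = ∅ :=
  Set.eq_empty_of_forall_notMem fun p => p.bot_notMem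

lemma stoneMap_inf (a b : A) : stoneMap (a ⊓ b) = stoneMap a ∩ stoneMap b :=
  Set.ext fun _ => PFilter.inf_mem_iff

lemma stoneMap_sup (a b : A) : stoneMap (a ⊔ b) = stoneMap a ∪ stoneMap b :=
  Set.ext fun p => p.sup_mem_iff a b

lemma stoneMap_compl (a : A) : stoneMap aᶜ = (stoneMap a)ᶜ :=
  Set.ext fun p => p.compl_mem_iff a

/-- The ultrafilter theorem in topological form; it lets `F` be recovered from `φ(F)`. -/
lemma stoneFilterMap_subset_stoneMap {F : PFilter A} {a : A} :
    stoneFilterMap F ⊆ stoneMap a ↔ a ∈ F := by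
  refine ⟨fun h => ?_, fun h p hp => hp h⟩
  by_contra ha
  obtain ⟨p, hFp, hap⟩ := exists_ul_of_notMem ha
  exact hap (h hFp)

lemma stoneFilterMap_principal (a : A) : stoneFilterMap (PFilter.principal a) = stoneMap a :=
  Set.ext fun _ => PFilter.principal_le_iff

lemma stoneMap_subset_stoneMap {a b : A} : stoneMap a ⊆ stoneMap b ↔ a ≤ b := by
  rw [← stoneFilterMap_principal, stoneFilterMap_subset_stoneMap, PFilter.mem_principal]

lemma stoneFilterMap_injective : Function.Injective (stoneFilterMap (A := A)) := fun F G h =>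
  SetLike.ext fun a => by
    rw [← stoneFilterMap_subset_stoneMap, h, stoneFilterMap_subset_stoneMap]

lemma isOpen_stoneMap (a : A) : IsOpen (stoneMap a) :=
  isOpen_generateFrom_of_mem ⟨a, rfl⟩

lemma isClopen_stoneMap (a : A) : IsClopen (stoneMap a) :=
  ⟨⟨by rw [← stoneMap_compl]; exact isOpen_stoneMap _⟩, isOpen_stoneMap a⟩

lemma isTopologicalBasis_stoneMap : IsTopologicalBasis (Set.range (stoneMap (A := A))) := by
  refine isTopologicalBasis_of_subbasis_of_finiteInter rfl ⟨⟨⊤, stoneMap_top⟩, ?_⟩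
  rintro _ ⟨a, rfl⟩ _ ⟨b, rfl⟩
  exact ⟨a ⊓ b, stoneMap_inf a b⟩

instance : T2Space (Ul A) := by
  have key : ∀ (p q : Ul A) (a : A), a ∈ p.toFilter → a ∉ q.toFilter →
      ∃ u v : Set (Ul A), IsOpen u ∧ IsOpen v ∧ p ∈ u ∧ q ∈ v ∧ Disjoint u v :=
    fun p q a hp hq => ⟨stoneMap a, (stoneMap a)ᶜ, isOpen_stoneMap a,
      (isClopen_stoneMap a).compl.isOpen, hp, hq, disjoint_compl_right⟩
  refine ⟨fun p q hpq => ?_⟩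
  obtain ⟨a, ha⟩ : ∃ a, ¬(a ∈ p.toFilter ↔ a ∈ q.toFilter) := by
    by_contra! h
    exact hpq (Ul.ext h)
  by_cases hp : a ∈ p.toFilter
  · exact key p q a hp fun hq => ha ⟨fun _ => hq, fun _ => hp⟩
  · exact key p q aᶜ ((p.compl_mem_iff a).2 hp) fun hq =>
      ha ⟨fun h => (hp h).elim, fun h => ((q.compl_mem_iff a).1 hq h).elim⟩

instance : CompactSpace (Ul A) := by
  refine ⟨isCompact_iff_ultrafilter_le_nhds.2 fun f _ => ?_⟩
  -- The limit of `f` is the ultrafilter of all `a` with `φ(a) ∈ f`.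
  have hP : IsPFilter {a : A | stoneMap a ∈ f} := by
    refine IsPFilter.of_def ⟨⊤, ?_⟩ ?_ ?_
    · change stoneMap ⊤ ∈ f
      rw [stoneMap_top]
      exact Filter.univ_mem
    · intro a ha b hb
      refine ⟨a ⊓ b, ?_, inf_le_left, inf_le_right⟩
      change stoneMap (a ⊓ b) ∈ f
      rw [stoneMap_inf]
      exact Filter.inter_mem ha hb
    · intro a b hab ha
      exact Filter.mem_of_superset ha (stoneMap_subset_stoneMap.2 hab)
  refine ⟨⟨hP.toPFilter, isUltra_of_mem_or_compl_mem ?_ ?_⟩, Set.mem_univ _, ?_⟩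
  · change ¬ stoneMap ⊥ ∈ f
    rw [stoneMap_bot]
    exact f.empty_notMem
  · intro a
    change stoneMap a ∈ f ∨ stoneMap aᶜ ∈ f
    rw [stoneMap_compl]
    exact f.mem_or_compl_mem _
  · refine le_of_le_of_eq (le_iInf₂ ?_) nhds_generateFrom.symm
    rintro _ ⟨ha, a, rfl⟩
    exact Filter.le_principal_iff.2 ha

lemma isBooleanSpace_ul : IsBooleanSpace (Ul A) where
  compact := inferInstance
  hausdorff := inferInstance
  zeroDim := isTopologicalBasis_stoneMap.of_isOpen_of_subset (fun _ h => h.isOpen) <| by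
    rintro _ ⟨a, rfl⟩
    exact isClopen_stoneMap a

/-- By compactness finitely many basic sets inside `W` cover `Z`, and their union is again basic.
Hence clopen sets have the form `φ(a)` and closed sets the form `φ(F)`. -/
lemma exists_stoneMap_between {Z W : Set (Ul A)} (hZ : IsClosed Z) (hW : IsOpen W)
    (hZW : Z ⊆ W) : ∃ a, Z ⊆ stoneMap a ∧ stoneMap a ⊆ W := by
  refine hZ.isCompact.induction_on (p := fun s => ∃ a, s ⊆ stoneMap a ∧ stoneMap a ⊆ W)
    ⟨⊥, Set.empty_subset _, by simp [stoneMap_bot]⟩ ?_ ?_ ?_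
  · rintro s t hst ⟨a, h1, h2⟩
    exact ⟨a, hst.trans h1, h2⟩
  · rintro s t ⟨a, h1, h2⟩ ⟨b, h3, h4⟩
    refine ⟨a ⊔ b, ?_, ?_⟩ <;> rw [stoneMap_sup]
    · exact Set.union_subset_union h1 h3
    · exact Set.union_subset h2 h4
  · intro p hp
    obtain ⟨_, ⟨a, rfl⟩, hpa, haW⟩ :=
      isTopologicalBasis_stoneMap.exists_subset_of_mem_open (hZW hp) hW
    exact ⟨stoneMap a, mem_nhdsWithin_of_mem_nhds ((isOpen_stoneMap a).mem_nhds hpa),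
      a, subset_rfl, haW⟩

lemma exists_eq_stoneMap {U : Set (Ul A)} (hU : IsClopen U) : ∃ a, stoneMap a = U := by
  obtain ⟨a, h1, h2⟩ := exists_stoneMap_between hU.isClosed hU.isOpen subset_rfl
  exact ⟨a, h2.antisymm h1⟩

lemma isClosed_stoneFilterMap (F : PFilter A) : IsClosed (stoneFilterMap F) := by
  have : stoneFilterMap F = ⋂ a ∈ F, stoneMap a := by
    ext p
    simp [stoneFilterMap, SetLike.le_def]
  rw [this]
  exact isClosed_biInter fun a _ => (isClopen_stoneMap a).isClosed

lemma exists_eq_stoneFilterMap {Z : Set (Ul A)} (hZ : IsClosed Z) :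
    ∃ F : PFilter A, Z = stoneFilterMap F := by
  have hP : IsPFilter {a : A | Z ⊆ stoneMap a} := by
    refine IsPFilter.of_def ⟨⊤, ?_⟩ ?_ fun {a b} hab ha => ha.trans (stoneMap_subset_stoneMap.2 hab)
    · simp [stoneMap_top]
    · intro a ha b hb
      refine ⟨a ⊓ b, ?_, inf_le_left, inf_le_right⟩
      change Z ⊆ stoneMap (a ⊓ b)
      rw [stoneMap_inf]
      exact Set.subset_inter ha hb
  refine ⟨hP.toPFilter, Set.Subset.antisymm (fun p hp a ha => ha hp) fun p hp => ?_⟩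
  by_contra hpZ
  obtain ⟨a, h1, h2⟩ := exists_stoneMap_between hZ isClosed_singleton.isOpen_compl
    (Set.subset_compl_singleton_iff.2 hpZ)
  exact h2 (hp h1) rfl

lemma continuous_ulMap {B : Type v} [BooleanAlgebra B] (h : BoundedLatticeHom A B) :
    Continuous (ulMap h) := by
  refine continuous_generateFrom_iff.2 ?_
  rintro _ ⟨a, rfl⟩
  exact isOpen_stoneMap (h a)

/-- The Stone map as an isomorphism of `A` with the clopen algebra of its Stone space. -/
noncomputable def stoneIso (A : Type u) [BooleanAlgebra A] : A ≃o Clopens (Ul A) :=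
  RelIso.ofSurjective
    (OrderEmbedding.ofMapLEIff (fun a => (⟨stoneMap a, isClopen_stoneMap a⟩ : Clopens (Ul A)))
      fun _ _ => stoneMap_subset_stoneMap)
    fun U => by
      obtain ⟨a, ha⟩ := exists_eq_stoneMap U.isClopen
      exact ⟨a, Clopens.ext ha⟩

end StoneDuality

/-! ### Boolean spaces as Stone spaces of their clopen algebras -/

section BooleanSpaces

variable {X : Type u} [TopologicalSpace X]

@[simp]
lemma mem_pointUl {x : X} {U : Clopens X} : U ∈ (pointUl x).toFilter ↔ x ∈ U := Iff.rfl

lemma IsBooleanSpace.exists_clopen_separating (hX : IsBooleanSpace X) {Z : Set X}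
    (hZ : IsClosed Z) {x : X} (hx : x ∉ Z) : ∃ U : Clopens X, Z ⊆ U ∧ x ∉ U := by
  obtain ⟨U, hU, hxU, hUZ⟩ := hX.zeroDim.exists_subset_of_mem_open hx hZ.isOpen_compl
  exact ⟨⟨Uᶜ, IsClopen.compl hU⟩, Set.subset_compl_comm.1 hUZ, fun h => h hxU⟩

lemma IsBooleanSpace.isHomeomorph_pointUl (hX : IsBooleanSpace X) :
    IsHomeomorph (pointUl : X → Ul (Clopens X)) := by
  have := hX.compact
  have := hX.hausdorff
  rw [isHomeomorph_iff_continuous_bijective]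
  refine ⟨continuous_generateFrom_iff.2 ?_, fun x y hxy => ?_, fun p => ?_⟩
  · rintro _ ⟨U, rfl⟩
    exact U.isClopen.isOpen
  · by_contra hne
    obtain ⟨U, hU, hx⟩ := hX.exists_clopen_separating isClosed_singleton
      (Set.mem_singleton_iff.not.2 hne)
    have hy : U ∈ (pointUl y).toFilter := hU rfl
    rw [← hxy] at hy
    exact hx hy
  · have : Nonempty {U // U ∈ p.toFilter} := ⟨⟨⊤, PFilter.top_mem⟩⟩
    -- Surjectivity: the members of `p` are nonempty compact sets directed downwards, so they share
    -- a point `x`; maximality of `p` then gives `p = ε(x)`.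
    obtain ⟨x, hx⟩ := IsCompact.nonempty_iInter_of_directed_nonempty_isCompact_isClosed
      (fun U : {U // U ∈ p.toFilter} => ((U : Clopens X) : Set X))
      (fun U V => ⟨⟨U.1 ⊓ V.1, PFilter.inf_mem U.2 V.2⟩, Set.inter_subset_left,
        Set.inter_subset_right⟩)
      (fun U => Set.nonempty_iff_ne_empty.2 fun h => p.bot_notMem <| by
        have hU : (U : Clopens X) = ⊥ := Clopens.ext h
        exact hU ▸ U.2)
      (fun U => U.1.isClopen.isClosed.isCompact) (fun U => U.1.isClopen.isClosed)
    have hx' : ∀ U ∈ p.toFilter, x ∈ U := fun U hU => Set.mem_iInter.1 hx ⟨U, hU⟩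
    refine ⟨x, Ul.ext fun U => ⟨fun h => ?_, hx' U⟩⟩
    by_contra hU
    exact hx' Uᶜ ((p.compl_mem_iff U).2 hU) h

end BooleanSpaces

/-! ### The conditional space of a conditional algebra -/

section UlRel

variable {A : Type u} [BooleanAlgebra A] {c : A → A → A}

lemma IsConditional.antitone_left (hc : IsConditional c) {a b : A} (h : a ≤ b) (d : A) :
    c b d ≤ c a d := by
  have := (hc.sup_left a b d).trans inf_le_left
  rwa [sup_eq_right.2 h] at this

lemma IsConditional.mono_right (hc : IsConditional c) (a : A) {b d : A} (h : b ≤ d) :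
    c a b ≤ c a d := by
  have := hc.inf_right a b d
  rw [inf_eq_left.2 h] at this
  exact inf_eq_left.1 this

/-- Since `φ` is injective on filters, the filter witnessing `T_A` can only be `F`. -/
lemma ulRel_stoneFilterMap {p q : Ul A} {F : PFilter A} :
    ulRel c p (stoneFilterMap F) q ↔
      ∀ a ∈ F, ∀ b, c a b ∈ p.toFilter → b ∈ q.toFilter := by
  constructor
  · rintro ⟨G, hG, h⟩ a ha b hab
    obtain rfl := stoneFilterMap_injective hG
    exact h ⟨a, ha, hab⟩
  · rintro h
    exact ⟨F, rfl, fun b ⟨a, ha, hab⟩ => h a ha b hab⟩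

/-- Antitonicity in the antecedent reduces the principal filter to its generator. -/
lemma IsConditional.ulRel_stoneMap (hc : IsConditional c) {p q : Ul A} {a : A} :
    ulRel c p (stoneMap a) q ↔ ∀ b, c a b ∈ p.toFilter → b ∈ q.toFilter := by
  rw [← stoneFilterMap_principal, ulRel_stoneFilterMap]
  exact ⟨fun h => h a le_rfl,
    fun h a' ha' b hb => h b (PFilter.mem_of_le (hc.antitone_left ha' b) hb)⟩

lemma IsConditional.image_ulRel_subset_iff (hc : IsConditional c) {p : Ul A} {a b : A} :
    image (ulRel c) p (stoneMap a) ⊆ stoneMap b ↔ c a b ∈ p.toFilter := by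
  refine ⟨fun h => ?_, fun h q hq => hc.ulRel_stoneMap.1 hq b h⟩
  -- If `b` were outside this filter, an ultrafilter extending it and omitting `b` would lie in
  -- `T_A(p, φ(a))` but not in `φ(b)`.
  have hP : IsPFilter {d : A | c a d ∈ p.toFilter} := by
    refine IsPFilter.of_def ⟨⊤, ?_⟩ ?_
      fun {x y} hxy hx => PFilter.mem_of_le (hc.mono_right a hxy) hx
    · simp [hc.top_right]
    · intro x hx y hy
      refine ⟨x ⊓ y, ?_, inf_le_left, inf_le_right⟩
      change c a (x ⊓ y) ∈ p.toFilter
      rw [← hc.inf_right]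
      exact PFilter.inf_mem hx hy
  by_contra hb
  obtain ⟨q, hq, hbq⟩ := exists_ul_of_notMem (F := hP.toPFilter) (a := b) hb
  exact hbq (h (hc.ulRel_stoneMap.2 fun d hd => hq hd))

/-- The clopen supersets of `φ(F)` are exactly the `φ(a)` with `a ∈ F`. -/
lemma IsConditional.ulRel_iff (hc : IsConditional c) {p q : Ul A} {Z : Set (Ul A)}
    (hZ : IsClosed Z) :
    ulRel c p Z q ↔ ∀ U : Set (Ul A), IsClopen U → Z ⊆ U → ulRel c p U q := by
  obtain ⟨F, rfl⟩ := exists_eq_stoneFilterMap hZ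
  rw [ulRel_stoneFilterMap]
  constructor
  · intro h U hU hFU
    obtain ⟨a, rfl⟩ := exists_eq_stoneMap hU
    exact hc.ulRel_stoneMap.2 (h a (stoneFilterMap_subset_stoneMap.1 hFU))
  · intro h a ha
    exact hc.ulRel_stoneMap.1
      (h _ (isClopen_stoneMap a) (stoneFilterMap_subset_stoneMap.2 ha))

/-- A clopen `U` is itself the largest admissible `Z`, and (T3) gives `T(x, Z) ⊆ T(x, U)` for closed
`Z ⊆ U`. -/
lemma setCond_eq_of_isClopen {X : Type u} [TopologicalSpace X] {T : X → Set X → X → Prop}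
    (hT : ∀ x Y y, IsClosed Y → (T x Y y ↔ ∀ U : Set X, IsClopen U → Y ⊆ U → T x U y))
    {U : Set X} (hU : IsClopen U) (V : Set X) :
    setCond {Z | IsClosed Z} T U V = {x | image T x U ⊆ V} := by
  ext x
  refine ⟨fun h => h U hU.isClosed subset_rfl, fun h Z hZ hZU y hy => h ?_⟩
  exact (hT x Z y hZ).1 hy U hU hZU

lemma IsConditional.isConditionalSpace_ul (hc : IsConditional c) :
    IsConditionalSpace (Ul A) (ulRel c) where
  boolean := isBooleanSpace_ul
  closed_mid := by
    rintro p _ q ⟨F, rfl, -⟩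
    exact isClosed_stoneFilterMap F
  isClosed_image p Z hZ := by
    obtain ⟨F, rfl⟩ := exists_eq_stoneFilterMap hZ
    have : image (ulRel c) p (stoneFilterMap F) =
        ⋂ a ∈ F, ⋂ b, ⋂ (_ : c a b ∈ p.toFilter), stoneMap b := by
      ext q
      simp [image, ulRel_stoneFilterMap]
    rw [this]
    exact isClosed_biInter fun a _ => isClosed_iInter fun b => isClosed_iInter fun _ =>
      (isClopen_stoneMap b).isClosed
  isClopen_cond U V hU hV := by
    rw [setCond_eq_of_isClopen (T := ulRel c) (fun _ _ _ => hc.ulRel_iff) hU]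
    obtain ⟨a, rfl⟩ := exists_eq_stoneMap hU
    obtain ⟨b, rfl⟩ := exists_eq_stoneMap hV
    simp_rw [hc.image_ulRel_subset_iff]
    exact isClopen_stoneMap (c a b)
  rel_iff _ _ _ := hc.ulRel_iff

lemma IsConditionalHom.isConditionalFunction_ulMap {B : Type v} [BooleanAlgebra B]
    {d : B → B → B} (hc : IsConditional c) (hd : IsConditional d) {h : BoundedLatticeHom A B}
    (hh : IsConditionalHom c d h) : IsConditionalFunction (ulRel d) (ulRel c) (ulMap h) where
  continuous := continuous_ulMap h
  image_subset_iff p U V hU hV := by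
    obtain ⟨a, rfl⟩ := exists_eq_stoneMap hU
    obtain ⟨b, rfl⟩ := exists_eq_stoneMap hV
    rw [hc.image_ulRel_subset_iff, mem_ulMap, hh a b, ← hd.image_ulRel_subset_iff]
    -- The preimage of `φ(a)` under `f_h` is `φ(h a)` by definition.
    rfl

end UlRel

/-! ### The conditional algebra of a conditional space -/

lemma CS.mem_cond {X : CS.{u}} {U V : Clopens X.carrier} {x : X.carrier} :
    x ∈ X.cond U V ↔ image X.rel x U ⊆ V := by
  change x ∈ setCond _ _ _ _ ↔ _
  rw [setCond_eq_of_isClopen X.isConditionalSpace.rel_iff U.isClopen]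
  rfl

lemma CS.isConditional_cond (X : CS.{u}) : IsConditional X.cond where
  top_right U := Clopens.ext <| Set.eq_univ_of_forall fun _ _ _ _ => Set.subset_univ _
  inf_right U V W := Clopens.ext <| Set.ext fun x => by
    change x ∈ X.cond U V ∧ x ∈ X.cond U W ↔ x ∈ X.cond U (V ⊓ W)
    simp only [CS.mem_cond, Clopens.coe_inf, Set.subset_inter_iff]
  sup_left U V W := fun x hx =>
    ⟨fun Z hZ hZU => hx Z hZ (hZU.trans Set.subset_union_left),
      fun Z hZ hZV => hx Z hZ (hZV.trans Set.subset_union_right)⟩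

lemma CS.isConditionalHom_clopMap {X Y : CS.{u}} (f : X ⟶ Y) :
    IsConditionalHom Y.cond X.cond (clopMap f.toFun f.isConditionalFunction.continuous) :=
  fun U V => Clopens.ext <| Set.ext fun x => by
    change f.toFun x ∈ Y.cond U V ↔ x ∈ X.cond _ _
    rw [CS.mem_cond, CS.mem_cond]
    exact (f.isConditionalFunction.image_subset_iff x U V U.isClopen V.isClopen).symm

lemma CS.isConditionalIso_pointUl (X : CS.{u}) :
    IsConditionalIso X.rel (ulRel X.cond) (pointUl : X.carrier → Ul (Clopens X.carrier)) := by
  have hX := X.isConditionalSpace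
  have hε := hX.boolean.isHomeomorph_pointUl
  have hc := X.isConditional_cond
  have hpre : ∀ U : Clopens X.carrier, pointUl '' (U : Set X.carrier) = stoneMap U := fun U =>
    Set.image_preimage_eq (stoneMap U) hε.surjective
  have hclopen : ∀ (x y : X.carrier) (U : Clopens X.carrier), X.rel x U y ↔
      ulRel X.cond (pointUl x) (pointUl '' (U : Set X.carrier)) (pointUl y) := by
    intro x y U
    simp only [hpre, hc.ulRel_stoneMap, mem_pointUl, CS.mem_cond]
    refine ⟨fun h V hV => hV h, fun h => ?_⟩
    -- Closedness of `T(x, U)` is what allows a clopen `V` to separate it from `y`.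
    by_contra hy
    obtain ⟨V, hV, hyV⟩ := hX.boolean.exists_clopen_separating
      (hX.isClosed_image x U U.isClopen.isClosed) hy
    exact hyV (h V hV)
  have hclosed : ∀ Z : Set X.carrier, IsClosed (pointUl '' Z) ↔ IsClosed Z := fun Z =>
    hε.homeomorph.isClosed_image
  refine ⟨hε, fun x Z y => ?_⟩
  by_cases hZ : IsClosed Z
  · rw [hX.rel_iff x Z y hZ, hc.ulRel_iff ((hclosed Z).2 hZ)]
    constructor
    · intro h W hW hZW
      obtain ⟨U, rfl⟩ := exists_eq_stoneMap hW
      rw [← hpre] at hZW ⊢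
      exact (hclopen x y U).1 (h U U.isClopen ((Set.image_subset_image_iff hε.injective).1 hZW))
    · intro h U hU hZU
      refine (hclopen x y ⟨U, hU⟩).2 (h _ ?_ (Set.image_mono hZU))
      exact (hpre ⟨U, hU⟩).symm ▸ isClopen_stoneMap _
  -- Both relations fail at a middle argument that is not closed, and `ε` preserves and reflects
  -- closedness.
  · exact iff_of_false (fun h => hZ (hX.closed_mid x Z y h)) fun h =>
      hZ ((hclosed Z).1 (hc.isConditionalSpace_ul.closed_mid _ _ _ h))

/-! ### Isomorphisms -/

lemma IsConditionalIso.isConditionalFunction {X : Type u} {Y : Type v} [TopologicalSpace X]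
    [TopologicalSpace Y] {T : X → Set X → X → Prop} {S : Y → Set Y → Y → Prop} {f : X → Y}
    (hf : IsConditionalIso T S f) : IsConditionalFunction T S f where
  continuous := hf.isHomeomorph.continuous
  image_subset_iff x U V _ _ := by
    have h : ∀ y, y ∈ image T x (f ⁻¹' U) ↔ f y ∈ image S (f x) U := fun y => by
      change T _ _ _ ↔ S _ _ _
      rw [hf.rel_iff, Set.image_preimage_eq _ hf.isHomeomorph.surjective]
    refine ⟨fun hs y hy => ?_, fun hs y hy => hs ((h y).1 hy)⟩
    obtain ⟨y, rfl⟩ := hf.isHomeomorph.surjective y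
    exact hs ((h y).2 hy)

lemma IsConditionalIso.symm {X : Type u} {Y : Type v} [TopologicalSpace X]
    [TopologicalSpace Y] {T : X → Set X → X → Prop} {S : Y → Set Y → Y → Prop} {f : X → Y}
    (hf : IsConditionalIso T S f) : IsConditionalIso S T hf.isHomeomorph.homeomorph.symm where
  isHomeomorph := hf.isHomeomorph.homeomorph.symm.isHomeomorph
  rel_iff x Z y := by
    set e := hf.isHomeomorph.homeomorph
    have h := hf.rel_iff (e.symm x) (e.symm '' Z) (e.symm y)
    have he : ∀ z, f (e.symm z) = z := e.apply_symm_apply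
    simp only [he, Set.image_image, Set.image_id'] at h
    exact h.symm

/-- An isomorphism of conditional spaces is an isomorphism in the category `CS`. -/
noncomputable def CS.isoMk {X Y : CS.{u}} (f : X.carrier → Y.carrier)
    (hf : IsConditionalIso X.rel Y.rel f) : X ≅ Y where
  hom := ⟨f, hf.isConditionalFunction⟩
  inv := ⟨hf.isHomeomorph.homeomorph.symm, hf.symm.isConditionalFunction⟩
  hom_inv_id := CS.Hom.ext (funext hf.isHomeomorph.homeomorph.symm_apply_apply)
  inv_hom_id := CS.Hom.ext (funext hf.isHomeomorph.homeomorph.apply_symm_apply)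

/-- A lattice isomorphism preserving the conditional is an isomorphism in the category `CA`. -/
def CA.isoMk {A B : CA.{u}} (e : A.carrier ≃o B.carrier)
    (he : ∀ a b, e (A.cond a b) = B.cond (e a) (e b)) : A ≅ B where
  hom := ⟨(e : BoundedLatticeHom A.carrier B.carrier), he⟩
  inv := ⟨(e.symm : BoundedLatticeHom B.carrier A.carrier), fun a b => by
    change e.symm _ = A.cond (e.symm a) (e.symm b)
    rw [e.symm_apply_eq, he, e.apply_symm_apply, e.apply_symm_apply]⟩
  hom_inv_id := CA.Hom.ext (BoundedLatticeHom.ext e.symm_apply_apply)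
  inv_hom_id := CA.Hom.ext (BoundedLatticeHom.ext e.apply_symm_apply)

end CondDuality

/-! ### Assembly of the duality -/

theorem mainTheorem7 :
    -- the expanded Stone space of a conditional algebra is a conditional space
    ∃ (hEs : ∀ A : CA.{u}, IsConditionalSpace (Ul A.carrier) (ulRel A.cond))
    -- the clopen sets of a conditional space form a conditional algebra
      (hCo : ∀ X : CS.{u}, IsConditional X.cond)
    -- `f_h` is a conditional function for every conditional homomorphism `h`
      (hG : ∀ (A B : CA.{u}) (h : A ⟶ B),
        IsConditionalFunction (ulRel B.cond) (ulRel A.cond) (ulMap h.hom))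
    -- `h_f` is a conditional homomorphism for every conditional function `f`
      (hH : ∀ (X Y : CS.{u}) (f : X ⟶ Y),
        IsConditionalHom Y.cond X.cond (clopMap f.toFun f.isConditionalFunction.continuous)),
    -- every conditional space `X` is isomorphic to `Es(Co(X))` via `ε`
      (∀ X : CS.{u}, IsConditionalIso X.rel (Es hEs (Co hCo X)).rel
        (pointUl : X.carrier → Ul (Clopens X.carrier))) ∧
    -- the Stone maps `φ` form a natural isomorphism from the identity of `CA` to `H ∘ G`
      (∃ α : 𝟭 CA.{u} ≅ (functorG hEs hG).rightOp ⋙ functorH hCo hH,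
        ∀ (A : CA.{u}) (a : A.carrier),
          Clopens.carrier (α := Ul A.carrier) ((α.hom.app A).hom a) = stoneMap a) ∧
    -- the maps `ε` form a natural isomorphism from the identity of `CS` to `G ∘ H`
      (∃ β : 𝟭 CS.{u} ≅ (functorH hCo hH).rightOp ⋙ functorG hEs hG,
        ∀ (X : CS.{u}) (x : X.carrier),
          (β.hom.app X).toFun x = pointUl x) ∧
    -- `G` and `H` form an equivalence between the opposite of `CA` and `CS`
      (∃ e : CA.{u}ᵒᵖ ≌ CS.{u},
        e.functor = functorG hEs hG ∧ e.inverse = (functorH hCo hH).rightOp) := by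
  have hEs : ∀ A : CA.{u}, IsConditionalSpace (Ul A.carrier) (ulRel A.cond) :=
    fun A => A.isConditional.isConditionalSpace_ul
  have hCo : ∀ X : CS.{u}, IsConditional X.cond := CS.isConditional_cond
  have hG : ∀ (A B : CA.{u}) (h : A ⟶ B),
      IsConditionalFunction (ulRel B.cond) (ulRel A.cond) (ulMap h.hom) := fun A B h =>
    h.isConditionalHom.isConditionalFunction_ulMap A.isConditional B.isConditional
  have hH : ∀ (X Y : CS.{u}) (f : X ⟶ Y),
      IsConditionalHom Y.cond X.cond (clopMap f.toFun f.isConditionalFunction.continuous) :=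
    fun _ _ f => CS.isConditionalHom_clopMap f
  refine ⟨hEs, hCo, hG, hH, CS.isConditionalIso_pointUl, ?_⟩
  let α : 𝟭 CA.{u} ≅ (functorG hEs hG).rightOp ⋙ functorH hCo hH :=
    NatIso.ofComponents
      (fun A => CA.isoMk (A := A) (B := Co hCo (Es hEs A)) (stoneIso A.carrier) fun a b =>
        Clopens.ext <| Set.ext fun p =>
          (A.isConditional.image_ulRel_subset_iff (p := p) (a := a) (b := b)).symm.trans
            (CS.mem_cond (X := Es hEs A) (U := stoneIso A.carrier a)
              (V := stoneIso A.carrier b)).symm)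
      fun f => rfl
  let β : 𝟭 CS.{u} ≅ (functorH hCo hH).rightOp ⋙ functorG hEs hG :=
    NatIso.ofComponents
      (fun X => CS.isoMk (Y := Es hEs (Co hCo X)) pointUl X.isConditionalIso_pointUl)
      fun f => rfl
  refine ⟨⟨α, fun A a => rfl⟩, ⟨β, fun X x => rfl⟩, ?_⟩
  -- In the opposite category the unit is given by the inverses of the Stone isomorphisms.
  -- `Equivalence.mk` adjusts the unit, so no triangle identity has to be checked.
  exact ⟨.mk (functorG hEs hG) (functorH hCo hH).rightOp
    (NatIso.ofComponents (fun A => (α.app A.unop).symm.op)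
      fun f => Quiver.Hom.unop_inj (α.inv.naturality f.unop).symm) β.symm, rfl, rfl⟩
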